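/- Let $B$ be the braid group of the complex reflection group $G_{26}$, that is, the group with generators $s_1,s_2,t$ and relations $ts_2ts_2=s_2ts_2t$, $s_2s_1s_2=s_1s_2s_1$, $ts_1=s_1t$. Let $R=\mathbf{Z}[a,b,c,c^{-1},d,e,e^{-1}]$, and let $\hat A$ be the generic Hecke algebra of $G_{26}$, that is, the quotient of the group algebra $RB$ by the relations $s_i^3=as_i^2+bs_i+c$ ($i=1,2$) and $t^2=dt+e$. Let $A_3=\langle s_1,s_2\rangle\subset\hat A$ be the $R$-subalgebra generated by $s_1,s_2$ (the parabolic subalgebra of type $G_4$). Then there are elements $x_1=1,x_2,\dots,x_{24}$ of the subgroup of $B$ generated by $s_1,s_2$ and elements $y_1=1,y_2,\dots,y_{54}$ of $B$ such that the images of $y_1,\dots,y_{54}$ generate $\hat A$ as a left $A_3$-module, and the images of $x_1,\dots,x_{24}$ span $A_3$ as an $R$-module. Consequently $\hat A$ is spanned as an $R$-module by the images of the $24\cdot 54=1296$ elements $x_iy_j$ of $B$, among which is $1$. -/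

import Mathlib

namespace G26

/-- The three standard generators of the braid group of `G_26`. -/
inductive Gen
  | s1
  | s2
  | t

/-- The defining relators of the braid group of `G_26`:
`t s₂ t s₂ = s₂ t s₂ t`, `s₂ s₁ s₂ = s₁ s₂ s₁`, `t s₁ = s₁ t`. -/
def braidRelators : Set (FreeGroup Gen) :=
  let s1 := FreeGroup.of Gen.s1
  let s2 := FreeGroup.of Gen.s2
  let t := FreeGroup.of Gen.t
  {(t * s2 * t * s2) * (s2 * t * s2 * t)⁻¹,
   (s2 * s1 * s2) * (s1 * s2 * s1)⁻¹,
   (t * s1) * (s1 * t)⁻¹}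

/-- The braid group `B` of `G_26`. -/
abbrev Braid : Type := PresentedGroup braidRelators

/-- The image of a generator in the braid group. -/
def gen (g : Gen) : Braid := PresentedGroup.of g

/-- The Hecke relations in the group algebra `k B`:
`s_i ^ 3 = a s_i ^ 2 + b s_i + c` for `i = 1, 2`, and `t ^ 2 = d t + e`. -/
inductive HeckeRel (k : Type) [CommRing k] (a b c d e : k) :
    MonoidAlgebra k Braid → MonoidAlgebra k Braid → Prop
  | s1 : HeckeRel k a b c d e
      (MonoidAlgebra.of k Braid (gen Gen.s1) ^ 3)
      (a • MonoidAlgebra.of k Braid (gen Gen.s1) ^ 2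
        + b • MonoidAlgebra.of k Braid (gen Gen.s1) + c • 1)
  | s2 : HeckeRel k a b c d e
      (MonoidAlgebra.of k Braid (gen Gen.s2) ^ 3)
      (a • MonoidAlgebra.of k Braid (gen Gen.s2) ^ 2
        + b • MonoidAlgebra.of k Braid (gen Gen.s2) + c • 1)
  | t : HeckeRel k a b c d e
      (MonoidAlgebra.of k Braid (gen Gen.t) ^ 2)
      (d • MonoidAlgebra.of k Braid (gen Gen.t) + e • 1)

/-- The Hecke algebra of `G_26` over `k` with parameters `a, b, c, d, e`: the quotient of the
group algebra of the braid group by the two-sided ideal generated by the Hecke relations. -/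
abbrev Hecke (k : Type) [CommRing k] (a b c d e : k) : Type :=
  RingQuot (HeckeRel k a b c d e)

/-- The natural map from the braid group to the Hecke algebra. -/
noncomputable def ofBraid (k : Type) [CommRing k] (a b c d e : k) :
    Braid →* Hecke k a b c d e :=
  ((RingQuot.mkAlgHom k (HeckeRel k a b c d e)) :
    MonoidAlgebra k Braid →* Hecke k a b c d e).comp (MonoidAlgebra.of k Braid)

/-- Names of the five indeterminates. -/
inductive Param
  | a
  | b
  | c
  | d
  | e

/-- The generic ring of parameters `R = ℤ[a, b, c, c⁻¹, d, e, e⁻¹]`. -/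
abbrev R : Type :=
  Localization.Away
    (MvPolynomial.X Param.c * MvPolynomial.X Param.e : MvPolynomial Param ℤ)

/-- An indeterminate, as an element of `R`. -/
noncomputable def param (p : Param) : R :=
  algebraMap (MvPolynomial Param ℤ) R (MvPolynomial.X p)

/-- The generic Hecke algebra `Â` of `G_26`, over `R`. -/
abbrev GenericHecke : Type :=
  Hecke R (param Param.a) (param Param.b) (param Param.c) (param Param.d) (param Param.e)

/-- The natural map `B → Â`. -/
noncomputable def toHecke : Braid →* GenericHecke :=
  ofBraid R (param Param.a) (param Param.b) (param Param.c) (param Param.d) (param Param.e)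

/-- The parabolic subalgebra `A₃ = ⟨s₁, s₂⟩` of `Â`. -/
noncomputable def A3 : Subalgebra R GenericHecke :=
  Algebra.adjoin R {toHecke (gen Gen.s1), toHecke (gen Gen.s2)}

end G26

/-!
The braid `ζ = (t s₂ s₁)³` is central, and the claim is that `Â` is the sum of the six left
`A₃`-modules `ζ ^ k (A₃ + A₃ t A₃)` with `-2 ≤ k ≤ 3`. Since `s₁` commutes with `t`, and the image
of `⟨s₁⟩` has eight right cosets in `G₄`, each of them is generated by `ζ ^ k` and eight elements
`ζ ^ k t r`, whence `6 * (1 + 8) = 54` generators.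

Let `U` be the sum of the `ζ ^ k (A₃ + A₃ t A₃)` over all `k`. Explicit braid identities give
`A₃ t A₃ t A₃ ⊆ U`, so that `U` is stable under right multiplication by the generators and equals
`Â`. Starting from six consecutive exponents, a longer chain of identities reaches the preceding
one; the automorphism of the braid group that inverts the generators then gives the following one,
so that six consecutive exponents give all of `U`.

The Hecke relations enter only in this form: since `c` and `e` are units, a submodule of `Â` that
contains three consecutive points `p sᵢ ^ j q`, or two consecutive points `p t ^ j q`, contains all
points with `j ∈ ℤ`. Hence the argument is about sets of braids instead of submodules of `Â`.
-/

namespace G26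

/-- The letters of braid words: `a`, `b`, `t` stand for `s₁`, `s₂`, `t`, and capitals for their
inverses. -/
inductive Letter
  | a
  | b
  | t
  | A
  | B
  | T
  deriving DecidableEq

/-- Words in the generators of the braid group and their inverses; the decidable side of all
computations with explicit braids. -/
abbrev Word : Type := List Letter

open Letter

namespace Letter

/-- The braid represented by a letter. -/
def eval : Letter → Braid
  | a => gen Gen.s1
  | b => gen Gen.s2
  | t => gen Gen.t
  | A => (gen Gen.s1)⁻¹
  | B => (gen Gen.s2)⁻¹
  | T => (gen Gen.t)⁻¹

/-- The inverse letter. -/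
def inv : Letter → Letter
  | a => A
  | b => B
  | t => T
  | A => a
  | B => b
  | T => t

theorem eval_inv (x : Letter) : x.inv.eval = x.eval⁻¹ := by
  cases x <;> simp only [inv, eval, inv_inv]

/-- Whether a letter is one of `s₁`, `s₂` and their inverses. -/
def inParabolic : Letter → Bool
  | t | T => false
  | _ => true

/-- Whether a letter is a generator, as opposed to the inverse of one. -/
def isPos : Letter → Bool
  | a | b | t => true
  | _ => false

/-- The right complement of word reversing: for an inverse letter `x` and a generator `y`, a
positive word followed by a negative one with product `x y`, read off from the braid relation
between the two generators. -/
def complement : Letter → Letter → Option Word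
  | A, a | B, b | T, t => some []
  | A, b => some [b, a, B, A]
  | B, a => some [a, b, A, B]
  | A, t => some [t, A]
  | T, a => some [a, T]
  | B, t => some [t, b, t, B, T, B]
  | T, b => some [b, t, b, T, B, T]
  | _, _ => none

end Letter

theorem gen_t_mul_gen_s2 :
    gen Gen.t * gen Gen.s2 * gen Gen.t * gen Gen.s2 =
      gen Gen.s2 * gen Gen.t * gen Gen.s2 * gen Gen.t :=
  mul_inv_eq_one.mp (PresentedGroup.one_of_mem (rels := braidRelators) (Or.inl rfl))

theorem gen_s2_mul_gen_s1 :
    gen Gen.s2 * gen Gen.s1 * gen Gen.s2 = gen Gen.s1 * gen Gen.s2 * gen Gen.s1 :=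
  mul_inv_eq_one.mp (PresentedGroup.one_of_mem (rels := braidRelators) (Or.inr (Or.inl rfl)))

theorem gen_t_mul_gen_s1 : gen Gen.t * gen Gen.s1 = gen Gen.s1 * gen Gen.t :=
  mul_inv_eq_one.mp (PresentedGroup.one_of_mem (rels := braidRelators) (Or.inr (Or.inr rfl)))

theorem closure_range_gen : Subgroup.closure (Set.range gen) = ⊤ :=
  PresentedGroup.closure_range_of braidRelators

namespace Word

/-- The braid represented by a word. -/
def eval (w : Word) : Braid := (w.map Letter.eval).prod

@[simp]
theorem eval_nil : eval [] = 1 := rfl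

@[simp]
theorem eval_cons (x : Letter) (w : Word) : eval (x :: w) = x.eval * eval w :=
  List.prod_cons

@[simp]
theorem eval_append (v w : Word) : eval (v ++ w) = eval v * eval w := by
  simp only [eval, List.map_append, List.prod_append]

/-- The inverse word. -/
def inv (w : Word) : Word := (w.map Letter.inv).reverse

@[simp]
theorem eval_inv (w : Word) : eval (inv w) = (eval w)⁻¹ := by
  simp only [eval, inv, List.prod_inv_reverse, List.map_reverse, List.map_map]
  congr 3
  exact funext Letter.eval_inv

/-- The word of the `k`-th power of a word. -/
def zpow (w : Word) : ℤ → Word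
  | .ofNat n => (List.replicate n w).flatten
  | .negSucc n => (List.replicate (n + 1) (inv w)).flatten

theorem eval_flatten_replicate (n : ℕ) (w : Word) :
    eval (List.replicate n w).flatten = eval w ^ n := by
  simp [eval, List.map_flatten, List.prod_flatten]

@[simp]
theorem eval_zpow (w : Word) (k : ℤ) : eval (zpow w k) = eval w ^ k := by
  cases k with
  | ofNat n => exact (eval_flatten_replicate n w).trans (zpow_natCast _ n).symm
  | negSucc n => rw [zpow, eval_flatten_replicate, eval_inv, inv_pow, zpow_negSucc]

/-- The braid `x w`. The wrapper keeps the word visible, so that words are compared by computation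
when braids are unified. -/
def translate (x : Braid) (w : Word) : Braid := x * w.eval

theorem translate_eq (x : Braid) (w : Word) : translate x w = x * w.eval := rfl

theorem eval_mem {H : Subgroup Braid} {w : Word} (h : ∀ x ∈ w, x.eval ∈ H) : w.eval ∈ H :=
  list_prod_mem (by simpa only [List.forall_mem_map] using h)

theorem eval_complement {x y : Letter} {w : Word} (h : complement x y = some w) :
    eval w = x.eval * y.eval := by
  cases x <;> cases y <;> simp only [complement, Option.some.injEq, reduceCtorEq] at h <;>
    subst h <;> simp only [eval_cons, eval_nil, Letter.eval, mul_one, inv_mul_cancel] <;>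
    rw [eq_inv_mul_iff_mul_eq] <;>
    simp only [← mul_assoc, mul_inv_eq_iff_eq_mul, gen_t_mul_gen_s2, gen_s2_mul_gen_s1,
      gen_t_mul_gen_s1]

/-- Word reversing: replaces subwords (inverse letter)(generator) by their complement, in at most
`n` steps. The accumulator `u` is the part of the word already reversed, last letter first. -/
def reversing : (n : ℕ) → (u w : Word) → Word
  | 0, u, w => u.reverse ++ w
  | _ + 1, u, [] => u.reverse
  | n + 1, [], y :: w => reversing n [y] w
  | n + 1, x :: u, y :: w =>
    match complement x y with
    | some c => reversing n u (c ++ w)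
    | none => reversing n (y :: x :: u) w

theorem eval_reversing (n : ℕ) (u w : Word) :
    eval (reversing n u w) = eval u.reverse * eval w := by
  induction n generalizing u w with
  | zero => simp only [reversing, eval_append]
  | succ n ih =>
    match u, w with
    | u, [] => simp [reversing]
    | [], y :: w => simp [reversing, ih]
    | x :: u, y :: w =>
      rw [reversing]
      split
      · next c hc => simp [ih, eval_complement hc, mul_assoc]
      · simp [ih, mul_assoc]

/-- A sound test for a word to represent the trivial braid: a first reversing yields a positive
word `p` followed by a negative word `n`, and `p n` is trivial if `n p` reverses to the empty
word. Running out of the 100000 steps can only make the test fail. -/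
def isTrivial (w : Word) : Bool :=
  let v := reversing 100000 [] w
  (reversing 100000 [] (v.dropWhile isPos ++ v.takeWhile isPos)).isEmpty

theorem eval_eq_one_of_isTrivial {w : Word} (h : isTrivial w = true) : eval w = 1 := by
  have hswap := eval_reversing 100000 []
    ((reversing 100000 [] w).dropWhile isPos ++ (reversing 100000 [] w).takeWhile isPos)
  rw [List.isEmpty_iff.mp h, List.reverse_nil, eval_nil, one_mul, eval_append] at hswap
  have hw := eval_reversing 100000 [] w
  rw [← (reversing 100000 [] w).takeWhile_append_dropWhile (p := isPos), eval_append,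
    mul_eq_one_comm.mp hswap.symm, List.reverse_nil, eval_nil, one_mul] at hw
  exact hw.symm

/-- A sound test for two words to represent the same braid. -/
def equiv (v w : Word) : Bool := isTrivial (v ++ inv w)

theorem eval_eq_of_equiv {v w : Word} (h : equiv v w = true) : eval v = eval w := by
  have := eval_eq_one_of_isTrivial h
  rwa [eval_append, eval_inv, mul_inv_eq_one] at this

/-- The word `(t s₂ s₁)³`, whose braid generates the centre of the braid group. -/
def center : Word := [t, b, a, t, b, a, t, b, a]

end Word

/-- The central element `(t s₂ s₁)³` of the braid group. -/
def zeta : Braid := Word.center.eval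

theorem commute_zeta (x : Braid) : Commute zeta x := by
  have hgen (x : Letter) (h : Word.equiv (Word.center ++ [x]) ([x] ++ Word.center) = true) :
      zeta * x.eval * zeta⁻¹ = x.eval := by
    have := Word.eval_eq_of_equiv h
    simp only [Word.eval_append, Word.eval_cons, Word.eval_nil, mul_one] at this
    rw [zeta, this, mul_inv_cancel_right]
  have hconj : (MulAut.conj zeta).toMonoidHom = MonoidHom.id Braid := by
    refine PresentedGroup.ext fun g => ?_
    cases g
    · exact hgen a (by decide +kernel)
    · exact hgen b (by decide +kernel)
    · exact hgen t (by decide +kernel)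
  exact mul_inv_eq_iff_eq_mul.mp (DFunLike.congr_fun hconj x)

/-- The endomorphism of the braid group that inverts the generators; an involution, which sends
`ζ` to its inverse. -/
def invert : Braid →* Braid :=
  PresentedGroup.toGroup (f := fun g => (gen g)⁻¹) (by
    rintro r (rfl | rfl | rfl) <;>
      simp only [map_mul, map_inv, FreeGroup.lift_apply_of, mul_inv_eq_one] <;>
      apply inv_injective <;> simp only [mul_inv_rev, inv_inv, ← mul_assoc]
    · exact gen_t_mul_gen_s2.symm
    · exact gen_s2_mul_gen_s1
    · exact gen_t_mul_gen_s1.symm)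

theorem invert_gen (g : Gen) : invert (gen g) = (gen g)⁻¹ := PresentedGroup.toGroup.of _

theorem invert_invert (x : Braid) : invert (invert x) = x := by
  have : invert.comp invert = MonoidHom.id Braid := PresentedGroup.ext fun g => by
    change invert (invert (gen g)) = gen g
    rw [invert_gen, map_inv, invert_gen, inv_inv]
  exact DFunLike.congr_fun this x

theorem invert_eval (w : Word) : invert w.eval = Word.eval (w.map Letter.inv) := by
  rw [Word.eval, map_list_prod, Word.eval, List.map_map, List.map_map]
  congr 2
  ext x
  cases x <;>
    simp only [Function.comp_apply, Letter.eval, Letter.inv, map_inv, invert_gen, inv_inv]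

theorem invert_zeta : invert zeta = zeta⁻¹ := by
  rw [zeta, invert_eval, ← Word.eval_inv]
  exact Word.eval_eq_of_equiv (by decide +kernel)

/-- The parabolic subgroup `⟨s₁, s₂⟩` of the braid group. -/
abbrev parabolic : Subgroup Braid := Subgroup.closure {gen Gen.s1, gen Gen.s2}

theorem gen_s1_mem_parabolic : gen Gen.s1 ∈ parabolic := Subgroup.subset_closure (Or.inl rfl)

theorem gen_s2_mem_parabolic : gen Gen.s2 ∈ parabolic := Subgroup.subset_closure (Or.inr rfl)

theorem Word.eval_mem_parabolic {w : Word} (h : w.all inParabolic = true) :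
    w.eval ∈ parabolic := by
  refine eval_mem fun x hx => ?_
  have := List.all_eq_true.mp h x hx
  cases x
  · exact gen_s1_mem_parabolic
  · exact gen_s2_mem_parabolic
  · contradiction
  · exact inv_mem gen_s1_mem_parabolic
  · exact inv_mem gen_s2_mem_parabolic
  · contradiction

theorem invert_mem_parabolic {h : Braid} (hh : h ∈ parabolic) : invert h ∈ parabolic := by
  suffices parabolic ≤ parabolic.comap invert from this hh
  rw [Subgroup.closure_le]
  rintro _ (rfl | rfl)
  all_goals rw [SetLike.mem_coe, Subgroup.mem_comap, invert_gen]
  · exact inv_mem gen_s1_mem_parabolic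
  · exact inv_mem gen_s2_mem_parabolic

open Word (translate translate_eq)

/-! ### Line-closed sets of braids -/

theorem forall_of_window {Q : ℤ → Prop} {n : ℕ} (up : ∀ i, (∀ m < n, Q (i + m)) → Q (i + n))
    (down : ∀ i, (∀ m < n, Q (i + 1 + m)) → Q i) {i : ℤ} (h : ∀ m < n, Q (i + m)) (j : ℤ) :
    Q j := by
  have window (l : ℤ) : ∀ m < n + 1, Q (l + m) := by
    have extend {l : ℤ} (hl : ∀ m < n, Q (l + m)) : ∀ m < n + 1, Q (l + m) :=
      Nat.forall_lt_succ_right.mpr ⟨hl, up l hl⟩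
    induction l using Int.inductionOn' (b := i) with
    | zero => exact extend h
    | succ l _ ih =>
      refine extend fun m hm => ?_
      rw [add_assoc, add_comm (1 : ℤ), ← Nat.cast_succ]
      exact ih (m + 1) (by lia)
    | pred l _ ih =>
      have hl (m : ℕ) (hm : m < n) : Q (l - 1 + 1 + m) := by
        simpa using ih m (by lia)
      rintro (_ | m) hm
      · simpa using down _ hl
      · simpa [add_assoc, add_comm (1 : ℤ)] using hl m (by lia)
  simpa using window j 0 n.succ_pos

/-- The degree of the Hecke relation satisfied by a generator. -/
def order : Gen → ℕ
  | Gen.s1 | Gen.s2 => 3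
  | Gen.t => 2

/-- A set of braids is *line closed* if it contains a line `{p g ^ j q | j ∈ ℤ}`, with `g` a
generator, as soon as it contains as many consecutive points of it as the degree of the Hecke
relation of `g`. Preimages of submodules of the Hecke algebra have this property, through which
alone the Hecke relations enter the argument. -/
structure IsLineClosed (S : Set Braid) : Prop where
  line_mem (g : Gen) (p q : Braid) (i : ℤ) (h : ∀ m < order g, p * gen g ^ (i + m) * q ∈ S)
    (j : ℤ) : p * gen g ^ j * q ∈ S

theorem translate_append_zpow (x : Braid) (p q : Word) (y : Letter) (i : ℤ) :
    translate x (p ++ .zpow [y] i ++ q) = x * p.eval * y.eval ^ i * q.eval := by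
  simp only [translate_eq, Word.eval_append, Word.eval_zpow, Word.eval_cons, Word.eval_nil, mul_one,
    mul_assoc]

namespace IsLineClosed

variable {S : Set Braid} (hS : IsLineClosed S)
include hS

theorem preimage_mul_left (x : Braid) : IsLineClosed ((x * ·) ⁻¹' S) where
  line_mem g p q i h j := by
    simp only [Set.mem_preimage, ← mul_assoc] at h ⊢
    exact hS.line_mem g (x * p) q i h j

theorem preimage_mul_right (x : Braid) : IsLineClosed ((· * x) ⁻¹' S) where
  line_mem g p q i h j := by
    simp only [Set.mem_preimage, mul_assoc _ q x] at h ⊢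
    exact hS.line_mem g p (q * x) i h j

theorem preimage_invert : IsLineClosed (invert ⁻¹' S) where
  line_mem g p q i h j := by
    simp only [Set.mem_preimage, map_mul, map_zpow, invert_gen, inv_zpow'] at h ⊢
    refine hS.line_mem g _ _ (-(i + (order g - 1 : ℕ))) (fun m hm => ?_) _
    convert h (order g - 1 - m) (by lia) using 4
    lia

theorem line_t (x : Braid) (p q : Word) (i j : ℤ) {w : Word}
    (h₀ : translate x (p ++ .zpow [t] i ++ q) ∈ S)
    (h₁ : translate x (p ++ .zpow [t] (i + 1) ++ q) ∈ S)
    (hw : w = p ++ .zpow [t] j ++ q := by decide +kernel) : translate x w ∈ S := by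
  rw [translate_append_zpow] at h₀ h₁
  rw [hw, translate_append_zpow]
  refine hS.line_mem Gen.t _ _ i (fun
    | 0, _ => ?_
    | 1, _ => h₁) j
  rwa [Nat.cast_zero, add_zero]

theorem line_of_order_eq_three {g : Gen} {y : Letter} (hy : y.eval = gen g) (hg : order g = 3)
    (x : Braid) (p q : Word) (i j : ℤ)
    (h₀ : translate x (p ++ .zpow [y] i ++ q) ∈ S)
    (h₁ : translate x (p ++ .zpow [y] (i + 1) ++ q) ∈ S)
    (h₂ : translate x (p ++ .zpow [y] (i + 2) ++ q) ∈ S) :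
    translate x (p ++ .zpow [y] j ++ q) ∈ S := by
  rw [translate_append_zpow, hy] at h₀ h₁ h₂ ⊢
  refine hS.line_mem g _ _ i (hg ▸ fun
    | 0, _ => ?_
    | 1, _ => h₁
    | 2, _ => h₂) j
  rwa [Nat.cast_zero, add_zero]

theorem line_a (x : Braid) (p q : Word) (i j : ℤ) {w : Word}
    (h₀ : translate x (p ++ .zpow [a] i ++ q) ∈ S)
    (h₁ : translate x (p ++ .zpow [a] (i + 1) ++ q) ∈ S)
    (h₂ : translate x (p ++ .zpow [a] (i + 2) ++ q) ∈ S)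
    (hw : w = p ++ .zpow [a] j ++ q := by decide +kernel) : translate x w ∈ S :=
  hw ▸ hS.line_of_order_eq_three (g := Gen.s1) rfl rfl x p q i j h₀ h₁ h₂

theorem line_b (x : Braid) (p q : Word) (i j : ℤ) {w : Word}
    (h₀ : translate x (p ++ .zpow [b] i ++ q) ∈ S)
    (h₁ : translate x (p ++ .zpow [b] (i + 1) ++ q) ∈ S)
    (h₂ : translate x (p ++ .zpow [b] (i + 2) ++ q) ∈ S)
    (hw : w = p ++ .zpow [b] j ++ q := by decide +kernel) : translate x w ∈ S :=
  hw ▸ hS.line_of_order_eq_three (g := Gen.s2) rfl rfl x p q i j h₀ h₁ h₂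

end IsLineClosed

theorem closure_subset_of_isLineClosed {𝒞 : Set (Set Braid)} {G : Set Braid}
    (hG : G ⊆ Set.range gen) (one : ∀ S ∈ 𝒞, 1 ∈ S) (line : ∀ S ∈ 𝒞, IsLineClosed S)
    (mul : ∀ S ∈ 𝒞, ∀ g ∈ G, (· * g) ⁻¹' S ∈ 𝒞) {S : Set Braid} (hS : S ∈ 𝒞) :
    (Subgroup.closure G : Set Braid) ⊆ S := by
  intro x hx
  induction hx using Subgroup.closure_induction_right generalizing S with
  | one => exact one S hS
  | mul_right _ _ g hg ih => exact ih (mul S hS g hg)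
  | mul_inv_cancel y _ g hg ih =>
    have hpow (m : ℕ) : y * g ^ m ∈ S := by
      induction m generalizing S with
      | zero => simpa using ih hS
      | succ m ihm => simpa [pow_succ, mul_assoc] using ihm (mul S hS g hg)
    obtain ⟨g, rfl⟩ := hG hg
    simpa using (line S hS).line_mem g y 1 0 (fun m _ => by simpa using hpow m) (-1)

/-! ### The parabolic subgroup -/

/-- Representatives of the right cosets of the image of `⟨s₁⟩` in the group `G₄ = ⟨s₁, s₂⟩`. -/
def representative : Fin 8 → Word :=
  ![[], [b], [b, a], [b, A], [B], [B, a], [B, A], [b, a, a, b]]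

/-- The 24 words whose images span the parabolic subalgebra. -/
def parabolicWord (p : Fin 3 × Fin 8) : Word := .zpow [a] (p.1 : ℕ) ++ representative p.2

theorem eval_parabolicWord_mem (p : Fin 3 × Fin 8) : (parabolicWord p).eval ∈ parabolic := by
  refine Word.eval_mem_parabolic ?_
  revert p
  decide

theorem mem_of_equiv_zpow_append {Q : Set Braid} (i l : ℤ) {v w : Word}
    (hv : translate (gen Gen.s1 ^ (i + l)) v ∈ Q)
    (h : Word.equiv w (.zpow [a] l ++ v) = true := by decide +kernel) :
    translate (gen Gen.s1 ^ i) w ∈ Q := by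
  rw [translate_eq] at hv ⊢
  rw [Word.eval_eq_of_equiv h, Word.eval_append, Word.eval_zpow, Word.eval_cons, Word.eval_nil,
    mul_one, ← mul_assoc]
  rwa [zpow_add] at hv

/-- A line-closed set which contains all braids `s₁ ^ i r` with `r` a representative. -/
structure ContainsRepresentatives (Q : Set Braid) : Prop extends IsLineClosed Q where
  mem (i : ℤ) (j : Fin 8) : translate (gen Gen.s1 ^ i) (representative j) ∈ Q

namespace ContainsRepresentatives

variable {Q : Set Braid} (hQ : ContainsRepresentatives Q)
include hQ

theorem mem_word (i l : ℤ) (j : Fin 8) {w : Word}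
    (h : Word.equiv w (.zpow [a] l ++ representative j) = true := by decide +kernel) :
    translate (gen Gen.s1 ^ i) w ∈ Q :=
  G26.mem_of_equiv_zpow_append i l (hQ.mem _ j) h

theorem mem_baa (i : ℤ) : translate (gen Gen.s1 ^ i) [b, a, a] ∈ Q :=
  hQ.line_a _ [b] [] (-1) 2 (hQ.mem_word i 0 3) (hQ.mem_word i 0 1) (hQ.mem_word i 0 2)

theorem mem_Baa (i : ℤ) : translate (gen Gen.s1 ^ i) [B, a, a] ∈ Q :=
  hQ.line_a _ [B] [] (-1) 2 (hQ.mem_word i 0 6) (hQ.mem_word i 0 4) (hQ.mem_word i 0 5)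

theorem mem_bb (i : ℤ) : translate (gen Gen.s1 ^ i) [b, b] ∈ Q :=
  hQ.line_b _ [] [] (-1) 2 (hQ.mem_word i 0 4) (hQ.mem_word i 0 0) (hQ.mem_word i 0 1)

theorem mem_bba (i : ℤ) : translate (gen Gen.s1 ^ i) [b, b, a] ∈ Q :=
  hQ.line_b _ [] [a] (-1) 2 (hQ.mem_word i 0 5) (hQ.mem_word i 1 0) (hQ.mem_word i 0 2)

theorem mem_bAb (i : ℤ) : translate (gen Gen.s1 ^ i) [b, A, b] ∈ Q :=
  hQ.line_a _ [b] [b] 0 (-1) (hQ.mem_bb i) (hQ.mem_word i 1 2) (hQ.mem_word i 0 7)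

theorem mem_baabb (i : ℤ) : translate (gen Gen.s1 ^ i) [b, a, a, b, b] ∈ Q :=
  hQ.line_b _ [b, a, a] [] (-1) 2 (mem_of_equiv_zpow_append i (-1) (hQ.mem_bba _)) (hQ.mem_baa i)
    (hQ.mem_word i 0 7)

theorem preimage_mul_s1 : ContainsRepresentatives ((· * gen Gen.s1) ⁻¹' Q) where
  toIsLineClosed := hQ.toIsLineClosed.preimage_mul_right _
  mem i j := by
    suffices translate (gen Gen.s1 ^ i) (representative j ++ [a]) ∈ Q by
      simpa [translate_eq, Letter.eval, mul_assoc] using this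
    match j with
    | 0 => exact hQ.mem_word i 1 0
    | 1 => exact hQ.mem i 2
    | 2 => exact hQ.mem_baa i
    | 3 => exact hQ.mem_word i 0 1
    | 4 => exact hQ.mem i 5
    | 5 => exact hQ.mem_Baa i
    | 6 => exact hQ.mem_word i 0 4
    | 7 => exact hQ.mem_word i 1 7

theorem preimage_mul_s2 : ContainsRepresentatives ((· * gen Gen.s2) ⁻¹' Q) where
  toIsLineClosed := hQ.toIsLineClosed.preimage_mul_right _
  mem i j := by
    suffices translate (gen Gen.s1 ^ i) (representative j ++ [b]) ∈ Q by
      simpa [translate_eq, Letter.eval, mul_assoc] using this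
    match j with
    | 0 => exact hQ.mem i 1
    | 1 => exact hQ.mem_bb i
    | 2 => exact hQ.mem_word i 1 2
    | 3 => exact hQ.mem_bAb i
    | 4 => exact hQ.mem_word i 0 0
    | 5 => exact hQ.mem_word i 1 3
    | 6 => exact hQ.mem_word i 1 6
    | 7 => exact hQ.mem_baabb i

theorem parabolic_subset : (parabolic : Set Braid) ⊆ Q := by
  refine closure_subset_of_isLineClosed (𝒞 := {Q | ContainsRepresentatives Q}) ?_
    (fun Q hQ => by simpa [translate_eq, representative] using hQ.mem 0 0)
    (fun Q hQ => hQ.toIsLineClosed) ?_ hQ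
  · rintro _ (rfl | rfl) <;> exact Set.mem_range_self _
  · rintro Q hQ _ (rfl | rfl)
    exacts [hQ.preimage_mul_s1, hQ.preimage_mul_s2]

end ContainsRepresentatives

theorem IsLineClosed.parabolic_subset {Q : Set Braid} (hQ : IsLineClosed Q)
    (h : ∀ p, (parabolicWord p).eval ∈ Q) : (parabolic : Set Braid) ⊆ Q := by
  refine ContainsRepresentatives.parabolic_subset ⟨hQ, fun i j => ?_⟩
  have hmem (m : ℕ) (hm : m < 3) :
      1 * gen Gen.s1 ^ (0 + (m : ℤ)) * (representative j).eval ∈ Q := by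
    simpa [parabolicWord, Letter.eval] using h (⟨m, hm⟩, j)
  simpa [translate_eq] using hQ.line_mem Gen.s1 1 (representative j).eval 0 hmem i

/-! ### Saturated sets of braids -/

/-- The braid `ζ ^ k w`. -/
abbrev twist (k : ℤ) (w : Word) : Braid := translate (zeta ^ k) w

theorem twist_eq_eval (k : ℤ) (w : Word) : twist k w = Word.eval (.zpow Word.center k ++ w) := by
  simp only [twist, translate_eq, Word.eval_append, Word.eval_zpow, zeta]

/-- A line-closed set of braids which is stable under left multiplication by the parabolic subgroup;
preimages of left `A₃`-submodules of the Hecke algebra are of this kind. -/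
structure IsLeftSaturated (S : Set Braid) : Prop extends IsLineClosed S where
  mul_mem_left {h x : Braid} (hh : h ∈ parabolic) (hx : x ∈ S) : h * x ∈ S

/-- A line-closed set of braids which is stable under multiplication by the parabolic subgroup on
both sides. -/
structure IsSaturated (S : Set Braid) : Prop extends IsLeftSaturated S where
  mul_mem_right {x h : Braid} (hx : x ∈ S) (hh : h ∈ parabolic) : x * h ∈ S

/-- The largest subset of a set of braids which is stable under right multiplication by the
parabolic subgroup. -/
def rightCore (S : Set Braid) : Set Braid := {x | ∀ h ∈ parabolic, x * h ∈ S}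

theorem rightCore_subset (S : Set Braid) : rightCore S ⊆ S := fun x hx => by
  simpa using hx 1 (one_mem _)

theorem IsLeftSaturated.isSaturated_rightCore {S : Set Braid} (hS : IsLeftSaturated S) :
    IsSaturated (rightCore S) where
  line_mem g p q i h j u hu := by
    simp only [rightCore, Set.mem_ofPred_eq, mul_assoc _ q] at h ⊢
    exact hS.line_mem g p (q * u) i (fun m hm => h m hm u hu) j
  mul_mem_left hh hx u hu := by
    rw [mul_assoc]
    exact hS.mul_mem_left hh (hx u hu)
  mul_mem_right hx hh u hu := by
    rw [mul_assoc]
    exact hx _ (mul_mem hh hu)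

/-- The set contains the coset `ζ ^ k ⟨t⟩`; for the saturated preimage of an `A₃`-bimodule `M`, this
means that `M` contains `ζ ^ k (A₃ + A₃ t A₃)`. -/
def LevelOne (S : Set Braid) (k : ℤ) : Prop :=
  ∀ i : ℤ, zeta ^ k * gen Gen.t ^ i ∈ S

/-- The set contains `ζ ^ k ⟨t⟩ ⟨s₁, s₂⟩ ⟨t⟩`. -/
def LevelTwo (S : Set Braid) (k : ℤ) : Prop :=
  ∀ i j : ℤ, ∀ h ∈ parabolic, zeta ^ k * (gen Gen.t ^ i * h * gen Gen.t ^ j) ∈ S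

theorem levelOne_preimage_mul_zeta_zpow (S : Set Braid) (k l : ℤ) :
    LevelOne ((zeta ^ k * ·) ⁻¹' S) l ↔ LevelOne S (k + l) := by
  simp only [LevelOne, Set.mem_preimage, ← mul_assoc, zpow_add]

theorem levelTwo_preimage_mul_zeta_zpow (S : Set Braid) (k l : ℤ) :
    LevelTwo ((zeta ^ k * ·) ⁻¹' S) l ↔ LevelTwo S (k + l) := by
  simp only [LevelTwo, Set.mem_preimage, ← mul_assoc, zpow_add]

theorem LevelOne.preimage_invert {S : Set Braid} {k : ℤ} (hS : LevelOne S k) :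
    LevelOne (invert ⁻¹' S) (-k) := fun i => by
  simpa [invert_zeta, invert_gen] using hS (-i)

theorem LevelTwo.preimage_invert {S : Set Braid} {k : ℤ} (hS : LevelTwo S k) :
    LevelTwo (invert ⁻¹' S) (-k) := fun i j h hh => by
  simpa [invert_zeta, invert_gen] using hS (-i) (-j) _ (invert_mem_parabolic hh)

theorem preimage_invert_preimage_invert (S : Set Braid) : invert ⁻¹' (invert ⁻¹' S) = S := by
  ext x
  rw [Set.mem_preimage, Set.mem_preimage, invert_invert]

namespace IsSaturated

variable {S : Set Braid} (hS : IsSaturated S)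
include hS

theorem preimage_mul_zeta_zpow (k : ℤ) : IsSaturated ((zeta ^ k * ·) ⁻¹' S) where
  toIsLineClosed := hS.toIsLineClosed.preimage_mul_left _
  mul_mem_left {h x} hh hx := by
    rw [Set.mem_preimage, ((commute_zeta h).zpow_left k).left_comm]
    exact hS.mul_mem_left hh hx
  mul_mem_right hx hh := by
    rw [Set.mem_preimage, ← mul_assoc]
    exact hS.mul_mem_right hx hh

theorem preimage_invert : IsSaturated (invert ⁻¹' S) where
  toIsLineClosed := hS.toIsLineClosed.preimage_invert
  mul_mem_left hh hx := by
    rw [Set.mem_preimage, map_mul]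
    exact hS.mul_mem_left (invert_mem_parabolic hh) hx
  mul_mem_right hx hh := by
    rw [Set.mem_preimage, map_mul]
    exact hS.mul_mem_right hx (invert_mem_parabolic hh)

theorem transfer {k l : ℤ} (u : Word) {w₁ : Word} (hw₁ : twist k w₁ ∈ S) (v : Word) {w₂ : Word}
    (h : ((u ++ v).all inParabolic &&
      Word.equiv (.zpow Word.center l ++ w₂) (u ++ (.zpow Word.center k ++ w₁) ++ v)) = true := by
        decide +kernel) :
    twist l w₂ ∈ S := by
  obtain ⟨huv, hw⟩ := Bool.and_eq_true_iff.mp h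
  obtain ⟨hu, hv⟩ := Bool.and_eq_true_iff.mp ((List.all_append ..).symm.trans huv)
  rw [twist_eq_eval, Word.eval_eq_of_equiv hw, Word.eval_append, Word.eval_append,
    ← twist_eq_eval]
  exact hS.mul_mem_right (hS.mul_mem_left (Word.eval_mem_parabolic hu) hw₁)
    (Word.eval_mem_parabolic hv)

end IsSaturated

theorem LevelOne.mem {S : Set Braid} {k : ℤ} (hS : LevelOne S k) (i : ℤ) :
    twist k (.zpow [t] i) ∈ S := by
  simpa [translate_eq, Letter.eval] using hS i

theorem LevelTwo.mem {S : Set Braid} {k : ℤ} (hS : LevelTwo S k) (i : ℤ) (h : Word) (j : ℤ)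
    (hh : h.all inParabolic = true := by decide +kernel) :
    twist k (.zpow [t] i ++ h ++ .zpow [t] j) ∈ S := by
  simpa [translate_eq, Letter.eval, mul_assoc] using hS i j _ (Word.eval_mem_parabolic hh)

namespace IsSaturated

variable {S : Set Braid} (hS : IsSaturated S)
include hS

theorem tbt_mem (h₁ : LevelOne S 1) : twist 0 [t, b, t] ∈ S :=
  hS.transfer [A, B] (h₁.mem (-1)) [A, B, A]

theorem tBt_mem (h₀ : LevelOne S 0) (h₁ : LevelOne S (-1)) : twist 0 [t, B, t] ∈ S := by
  have tBT_mem : twist 0 [t, B, T] ∈ S := hS.line_t _ [] [B, T] (-1) 1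
    (hS.transfer [a, b] (h₁.mem 1) [a, b, a]) (hS.transfer [B] (h₀.mem (-1)) [])
  exact hS.line_t _ [t, B] [] (-1) 1 (hS.transfer [] tBT_mem []) (hS.transfer [] (h₀.mem 1) [B])

theorem tbaabt_mem (h₁ : LevelOne S 1) (h₂ : LevelOne S 2) (h₃ : LevelOne S 3) :
    twist 0 [t, b, a, a, b, t] ∈ S := by
  have tbT_mem_one : twist 1 [t, b, T] ∈ S := hS.line_t _ [t, b] [] 0 (-1)
    (hS.transfer [] (h₁.mem 1) [b]) (hS.transfer [A, B] (h₂.mem (-1)) [A, B, A])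
  have tbT_mem_two : twist 2 [t, b, T] ∈ S := hS.line_t _ [t, b] [] 0 (-1)
    (hS.transfer [] (h₂.mem 1) [b]) (hS.transfer [A, B] (h₃.mem (-1)) [A, B, A])
  have tbTBTT_mem : twist 2 [t, b, T, B, T, T] ∈ S := hS.line_t _ [t, b] [B, T, T] 0 (-1)
    (hS.transfer [] (h₂.mem (-1)) []) (hS.transfer [B] tbT_mem_two [])
  have tbtbAbT_mem : twist 1 [t, b, t, b, A, b, T] ∈ S := hS.line_a _ [t, b, t, b] [b, T] 0 (-1)
    (hS.transfer [b, b] (h₁.mem 1) [b]) (hS.transfer [A, B] (h₂.mem (-2)) [])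
    (hS.transfer [b, A] tbTBTT_mem [A])
  have tbTaBT_mem : twist 1 [t, b, T, a, B, T] ∈ S := hS.line_t _ [t, b] [a, B, T] 0 (-1)
    (hS.transfer [A] tbT_mem_one [a]) (hS.transfer [B, B] tbtbAbT_mem [a])
  exact hS.transfer [A] tbTaBT_mem [A, B]

end IsSaturated

namespace IsSaturated

variable {S : Set Braid} (hS : IsSaturated S)
include hS

theorem t_mul_representative_mul_t_mem (h : ∀ k : ℤ, -1 ≤ k → k ≤ 3 → LevelOne S k) (r : Fin 8) :
    twist 0 ([t] ++ representative r ++ [t]) ∈ S := by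
  have h₀ := h 0 (by decide) (by decide)
  have hb := hS.tbt_mem (h 1 (by decide) (by decide))
  have hB := hS.tBt_mem h₀ (h (-1) (by decide) (by decide))
  have hbaab := hS.tbaabt_mem (h 1 (by decide) (by decide)) (h 2 (by decide) (by decide))
    (h 3 (by decide) (by decide))
  match r with
  | 0 => exact hS.transfer [] (h₀.mem 2) []
  | 1 => exact hS.transfer [] hb []
  | 2 => exact hS.transfer [] hb [a]
  | 3 => exact hS.transfer [] hb [A]
  | 4 => exact hS.transfer [] hB []
  | 5 => exact hS.transfer [] hB [a]
  | 6 => exact hS.transfer [] hB [A]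
  | 7 => exact hS.transfer [] hbaab []

theorem t_zpow_mul_mul_t_zpow_mem (h₀ : LevelOne S 0) {h : Braid} (hh : h ∈ parabolic)
    (hmem : gen Gen.t * h * gen Gen.t ∈ S) (i j : ℤ) :
    gen Gen.t ^ i * h * gen Gen.t ^ j ∈ S := by
  have hright : gen Gen.t * h * gen Gen.t ^ j ∈ S := by
    simpa using hS.line_mem Gen.t (gen Gen.t * h) 1 0 (fun
      | 0, _ => by simpa using hS.mul_mem_right (h₀ 1) hh
      | 1, _ => by simpa using hmem) j
  simpa [mul_assoc] using hS.line_mem Gen.t 1 (h * gen Gen.t ^ j) 0 (fun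
    | 0, _ => by simpa using hS.mul_mem_left hh (h₀ j)
    | 1, _ => by simpa [mul_assoc] using hright) i

theorem levelTwo_zero (h : ∀ k : ℤ, -1 ≤ k → k ≤ 3 → LevelOne S k) : LevelTwo S 0 := by
  intro i j x hx
  have hclosed : IsLineClosed {y | gen Gen.t ^ i * y * gen Gen.t ^ j ∈ S} :=
    (hS.toIsLineClosed.preimage_mul_right (gen Gen.t ^ j)).preimage_mul_left (gen Gen.t ^ i)
  suffices ∀ p, gen Gen.t ^ i * (parabolicWord p).eval * gen Gen.t ^ j ∈ S by
    simpa using hclosed.parabolic_subset this hx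
  rintro ⟨m, r⟩
  have hr : (representative r).eval ∈ parabolic := by
    simpa [parabolicWord] using eval_parabolicWord_mem (0, r)
  have hmem := hS.t_zpow_mul_mul_t_zpow_mem (h 0 (by decide) (by decide)) hr
    (by simpa [translate_eq, Letter.eval, mul_assoc] using
      hS.t_mul_representative_mul_t_mem h r) i j
  have hcomm : Commute (gen Gen.t ^ i) (gen Gen.s1 ^ (m : ℕ)) :=
    (show Commute _ _ from gen_t_mul_gen_s1).zpow_left i |>.pow_right m
  simpa [parabolicWord, Letter.eval, mul_assoc, hcomm.left_comm] using
    hS.mul_mem_left (pow_mem gen_s1_mem_parabolic m) hmem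

theorem levelTwo_of_le {k : ℤ} (h : ∀ l : ℤ, k - 1 ≤ l → l ≤ k + 3 → LevelOne S l) :
    LevelTwo S k := by
  have := (hS.preimage_mul_zeta_zpow k).levelTwo_zero fun l h₁ h₂ =>
    (levelOne_preimage_mul_zeta_zpow S k l).mpr (h (k + l) (by lia) (by lia))
  simpa using (levelTwo_preimage_mul_zeta_zpow S k 0).mp this

theorem levelTwo_of_ge {k : ℤ} (h : ∀ l : ℤ, k - 3 ≤ l → l ≤ k + 1 → LevelOne S l) :
    LevelTwo S k := by
  have := (hS.preimage_invert.levelTwo_of_le (k := -k) fun l h₁ h₂ => by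
    simpa using (h (-l) (by lia) (by lia)).preimage_invert).preimage_invert
  rwa [preimage_invert_preimage_invert, neg_neg] at this

end IsSaturated

/-- A saturated set which reaches level one at the six powers `ζ ^ k` with `-2 ≤ k ≤ 3`. -/
structure HasWindow (S : Set Braid) : Prop extends IsSaturated S where
  levelOne (k : ℤ) (h₁ : -2 ≤ k) (h₂ : k ≤ 3) : LevelOne S k

namespace HasWindow

variable {S : Set Braid} (hS : HasWindow S)
include hS

theorem levelTwo (k : ℤ) (h₁ : -1 ≤ k) (h₂ : k ≤ 2) : LevelTwo S k := by
  rcases le_or_gt k 0 with hk | hk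
  · exact hS.levelTwo_of_le fun l _ _ => hS.levelOne l (by lia) (by lia)
  · exact hS.levelTwo_of_ge fun l _ _ => hS.levelOne l (by lia) (by lia)

theorem mem_one (k i : ℤ) (hk : -2 ≤ k ∧ k ≤ 3 := by decide +kernel) : twist k (.zpow [t] i) ∈ S :=
  (hS.levelOne k hk.1 hk.2).mem i

theorem mem_two (k i : ℤ) (h : Word) (j : ℤ)
    (hk : (-1 ≤ k ∧ k ≤ 2) ∧ h.all inParabolic = true := by decide +kernel) :
    twist k (.zpow [t] i ++ h ++ .zpow [t] j) ∈ S :=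
  (hS.levelTwo k hk.1.1 hk.1.2).mem i h j hk.2

end HasWindow

/-! ### From six consecutive powers of `ζ` to the preceding one

The facts passed to `line_t`, `line_a` and `line_b` are consecutive points of a line; each of them
is given as `transfer u h v`, which asserts that the point is `u x v` with `h : x ∈ S` and `u`, `v`
in the parabolic subgroup. -/

namespace HasWindow

variable {S : Set Braid} (hS : HasWindow S)
include hS

theorem twist_neg_two_Tbbt_mem : twist (-2) [T, b, b, t] ∈ S := by
  have twist_neg_two_tbbt_mem : twist (-2) [t, b, b, t] ∈ S :=
    hS.line_t _ [t, b] [b, t] 1 0 (hS.transfer [A, B] (hS.mem_two (-1) (-1) [B] 1) [A])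
      (hS.transfer [A, B] (hS.mem_two 0 (-1) [B, A, A, B] (-1)) [A, A, B, A])
  exact hS.line_t _ [] [b, b, t] 0 (-1) (hS.transfer [b, b] (hS.mem_one (-2) 1) [])
    (hS.transfer [] twist_neg_two_tbbt_mem [])

theorem twist_neg_two_tBT_mem : twist (-2) [t, B, T] ∈ S :=
  hS.line_b _ [t] [T] 0 (-1) (hS.transfer [] (hS.mem_one (-2) 0) [])
    (hS.transfer [B, A] (hS.mem_two (-1) (-2) [B] (-1)) [B, A])
    (hS.transfer [B] hS.twist_neg_two_Tbbt_mem [b])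

theorem twist_neg_two_TbtAbbT_mem : twist (-2) [T, b, t, A, b, b, T] ∈ S :=
  hS.line_t _ [] [b, t, A, b, b, T] 0 (-1) (hS.transfer [b, A, B] hS.twist_neg_two_Tbbt_mem [b])
    (hS.transfer [A, B] (hS.mem_two (-1) (-1) [B, a, B] (-1)) [A])

theorem twist_neg_one_TbtAbbT_mem : twist (-1) [T, b, t, A, b, b, T] ∈ S :=
  hS.line_t _ [] [b, t, A, b, b, T] 0 (-1)
    (hS.transfer [b, A, B] (hS.mem_two (-1) (-1) [b, b] 1) [b])
    (hS.transfer [A, B] (hS.mem_two 0 (-1) [B, a, B] (-1)) [A])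

theorem twist_one_ttbtbAbt_mem : twist 1 [t, t, b, t, b, A, b, t] ∈ S :=
  hS.line_t _ [] [b, t, b, A, b, t] 0 2 (hS.transfer [b] (hS.mem_two 1 1 [b, A, b] 1) [])
    (hS.transfer [b, A, B] (hS.mem_two 2 (-1) [B, B] 1) [A])

theorem twist_three_TBAABBAABT_mem : twist 3 [T, B, A, A, B, B, A, A, B, T] ∈ S := by
  have twist_one_ttbtbAAbt_mem : twist 1 [t, t, b, t, b, A, A, b, t] ∈ S :=
    hS.line_t _ [] [b, t, b, A, A, b, t] 0 2 (hS.transfer [b] (hS.mem_two 1 1 [b, A, A, b] 1) [])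
      (hS.transfer [b, A, B] (hS.mem_two 2 (-1) [B, B, B] 1) [A])
  have twist_one_ttbtbaabt_mem : twist 1 [t, t, b, t, b, a, a, b, t] ∈ S :=
    hS.line_t _ [] [b, t, b, a, a, b, t] 0 2 (hS.transfer [b] (hS.mem_two 1 1 [b, a, a, b] 1) [])
      (hS.transfer [b, A, B] (hS.mem_two 2 (-1) [b] 1) [A])
  have twist_three_TBBBT_mem : twist 3 [T, B, B, B, T] ∈ S :=
    hS.line_b _ [T] [T] (-2) (-3) (hS.transfer [b, a] twist_one_ttbtbaabt_mem [a, b, a])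
      (hS.transfer [a, b] (hS.mem_one 2 1) [a, b, a]) (hS.transfer [] (hS.mem_one 3 (-2)) [])
  have twist_three_TBaBBAABT_mem : twist 3 [T, B, a, B, B, A, A, B, T] ∈ S :=
    hS.line_b _ [T, B, a] [A, A, B, T] (-1) (-2)
      (hS.transfer [b, a, B] hS.twist_one_ttbtbAbt_mem [a, b, a, a, a])
      (hS.transfer [b] (hS.mem_one 2 1) [a, b]) (hS.transfer [] twist_three_TBBBT_mem [a])
  exact hS.line_b _ [T, B, A, A] [A, A, B, T] (-1) (-2)
    (hS.transfer [b, a, B] hS.twist_one_ttbtbAbt_mem [a, b])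
    (hS.transfer [b, a] twist_one_ttbtbAAbt_mem [a, b, a])
    (hS.transfer [a] twist_three_TBaBBAABT_mem [A])

theorem twist_zero_TbAbTabAbt_mem : twist 0 [T, b, A, b, T, a, b, A, b, t] ∈ S := by
  have twist_two_tBBAABT_mem : twist 2 [t, B, B, A, A, B, T] ∈ S :=
    hS.line_b _ [t] [A, A, B, T] 0 (-2) (hS.transfer [A, A, B] (hS.mem_two 2 (-1) [B] 1) [b])
      (hS.transfer [A, B] (hS.mem_two 2 (-1) [B, B] 1) [b, a])
      (hS.transfer [A] (hS.mem_two 2 1 [B, a, B] (-1)) [a])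
  have twist_one_tBBTAbt_mem : twist 1 [t, B, B, T, A, b, t] ∈ S :=
    hS.line_t _ [t, B, B] [A, b, t] 0 (-1) (hS.transfer [] (hS.mem_two 1 1 [B, a, B] 1) [A])
      (hS.transfer [] twist_two_tBBAABT_mem [A, B, A])
  have twist_two_TBBAABt_mem : twist 2 [T, B, B, A, A, B, t] ∈ S :=
    hS.line_b _ [T] [A, A, B, t] 0 (-2) (hS.transfer [A, A] (hS.mem_two 2 (-1) [B] 1) [])
      (hS.transfer [A] (hS.mem_two 2 (-1) [B, B] 1) [a])
      (hS.transfer [A] (hS.mem_two 2 (-1) [B, a, B] 1) [a])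
  have twist_one_tbtABBTAbt_mem : twist 1 [t, b, t, A, B, B, T, A, b, t] ∈ S :=
    hS.line_t _ [t, b, t, A, B, B] [A, b, t] 0 (-1)
      (hS.transfer [b, b, A, B] twist_two_TBBAABt_mem [A, A, A])
      (hS.transfer [A, B] hS.twist_three_TBAABBAABT_mem [A, A, B, A])
  have twist_zero_btbAbtabAbt_mem : twist 0 [b, t, b, A, b, t, a, b, A, b, t] ∈ S :=
    hS.line_t _ [] [b, t, b, A, b, t, a, b, A, b, t] 1 0
      (hS.transfer [b, A] twist_one_tBBTAbt_mem []) (hS.transfer [] twist_one_tbtABBTAbt_mem [])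
  have twist_zero_tbAbTabAbt_mem : twist 0 [t, b, A, b, T, a, b, A, b, t] ∈ S :=
    hS.line_t _ [t, b, A, b] [a, b, A, b, t] 0 (-1) (hS.transfer [] (hS.mem_two 0 1 [b, b, b] 1) [])
      (hS.transfer [B] twist_zero_btbAbtabAbt_mem [])
  exact hS.line_t _ [] [b, A, b, T, a, b, A, b, t] 0 (-1)
    (hS.transfer [b, b, a, B] (hS.mem_two 0 (-1) [b, A, b] 1) [])
    (hS.transfer [] twist_zero_tbAbTabAbt_mem [])

theorem twist_zero_TbAbTBaBt_mem : twist 0 [T, b, A, b, T, B, a, B, t] ∈ S := by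
  have twist_neg_one_tbbTabbtt_mem : twist (-1) [t, b, b, T, a, b, b, t, t] ∈ S :=
    hS.line_t _ [t, b, b, T, a, b, b] [] 0 2
      (hS.transfer [B] (hS.mem_two (-1) (-1) [b, b] 1) [a, a, b, a])
      (hS.transfer [B] (hS.mem_two 0 (-1) [b, A, b] (-1)) [B])
  have twist_one_TbTABTT_mem : twist 1 [T, b, T, A, B, T, T] ∈ S :=
    hS.line_t _ [T, b, T, A, B] [] (-1) (-2) (hS.transfer [] (hS.mem_two 0 (-1) [b, b] 1) [a, b, a])
      (hS.transfer [] (hS.mem_two 1 (-1) [b] (-1)) [A, B])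
  exact hS.line_b _ [T, b, A, b, T, B, a] [t] 0 (-1)
    (hS.transfer [b] twist_neg_one_tbbTabbtt_mem [a])
    (hS.transfer [] twist_one_TbTABTT_mem [A, B, A])
    (hS.transfer [] hS.twist_zero_TbAbTabAbt_mem [])

theorem twist_neg_one_TbtAbbTBaBt_mem : twist (-1) [T, b, t, A, b, b, T, B, a, B, t] ∈ S := by
  have twist_zero_TbttABBT_mem : twist 0 [T, b, t, t, A, B, B, T] ∈ S :=
    hS.line_t _ [T, b] [A, B, B, T] 0 2 (hS.transfer [A] (hS.mem_two 0 (-1) [B, a, B] (-1)) [])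
      (hS.transfer [b] (hS.mem_two (-1) 1 [b, A, b] 1) [a, b])
  have twist_neg_one_TbbtaBt_mem : twist (-1) [T, b, b, t, a, B, t] ∈ S :=
    hS.line_t _ [] [b, b, t, a, B, t] 0 (-1) (hS.transfer [b, b, a] (hS.mem_two (-1) 1 [B] 1) [])
      (hS.transfer [B] twist_zero_TbttABBT_mem [B])
  have twist_zero_TbtBaBt_mem : twist 0 [T, b, t, B, a, B, t] ∈ S :=
    hS.line_t _ [] [b, t, B, a, B, t] 0 (-1) (hS.transfer [b] (hS.mem_two 0 1 [B, a, B] 1) [])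
      (hS.transfer [A, B, A, A] (hS.mem_two 1 (-1) [B, B] 1) [])
  have twist_zero_TbTBaBt_mem : twist 0 [T, b, T, B, a, B, t] ∈ S :=
    hS.line_t _ [T, b] [B, a, B, t] 0 (-1) (hS.transfer [a] (hS.mem_two 0 (-1) [B] 1) [])
      (hS.transfer [] twist_zero_TbtBaBt_mem [])
  have twist_zero_TBBAbTBaBt_mem : twist 0 [T, B, B, A, b, T, B, a, B, t] ∈ S :=
    hS.line_b _ [T] [A, b, T, B, a, B, t] (-1) (-2)
      (hS.transfer [a, a, b, a, a] (hS.mem_two (-1) 1 [B] 1) [])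
      (hS.transfer [A] twist_zero_TbTBaBt_mem []) (hS.transfer [] hS.twist_zero_TbAbTBaBt_mem [])
  exact hS.line_t _ [] [b, t, A, b, b, T, B, a, B, t] 0 (-1)
    (hS.transfer [b, A, B] twist_neg_one_TbbtaBt_mem [])
    (hS.transfer [A, B] twist_zero_TBBAbTBaBt_mem [])

theorem twist_neg_one_TBTabbTaBT_mem : twist (-1) [T, B, T, a, b, b, T, a, B, T] ∈ S := by
  have twist_neg_one_TBTbaabT_mem : twist (-1) [T, B, T, b, a, a, b, T] ∈ S :=
    hS.line_t _ [T, B, T, b, a, a, b] [] 0 (-1)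
      (hS.transfer [a, b, a, a] (hS.mem_one (-2) 1) [b, a, a, a, b])
      (hS.transfer [b, b, a] hS.twist_neg_one_TbtAbbT_mem [B, A])
  have twist_neg_one_TbtAbbTBaBT_mem : twist (-1) [T, b, t, A, b, b, T, B, a, B, T] ∈ S :=
    hS.line_t _ [T, b, t, A, b, b, T, B, a, B] [] 0 (-1)
      (hS.transfer [] hS.twist_neg_one_TbtAbbT_mem [B, a, B])
      (hS.transfer [] hS.twist_neg_one_TbtAbbTBaBt_mem [])
  exact hS.line_t _ [T, B, T, a, b, b] [a, B, T] 0 (-1)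
    (hS.transfer [B, B, B] twist_neg_one_TBTbaabT_mem [a, a])
    (hS.transfer [a] twist_neg_one_TbtAbbTBaBT_mem [])

theorem twist_neg_three_tbaaBaabt_mem : twist (-3) [t, b, a, a, B, a, a, b, t] ∈ S := by
  have twist_neg_two_tbbbT_mem : twist (-2) [t, b, b, b, T] ∈ S :=
    hS.line_b _ [t] [T] 0 3 (hS.transfer [] (hS.mem_one (-2) 0) [])
      (hS.transfer [B, A] (hS.mem_two (-1) (-2) [B] (-1)) [B, A])
      (hS.transfer [B] hS.twist_neg_two_Tbbt_mem [b])
  have twist_neg_two_TbtAbbbT_mem : twist (-2) [T, b, t, A, b, b, b, T] ∈ S :=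
    hS.line_t _ [] [b, t, A, b, b, b, T] 0 (-1) (hS.transfer [b, A] twist_neg_two_tbbbT_mem [])
      (hS.transfer [A, B] (hS.mem_two (-1) (-1) [B, a, a, B] (-1)) [A])
  exact hS.line_b _ [t, b, a, a] [a, a, b, t] 0 (-1)
    (hS.transfer [B] twist_neg_two_TbtAbbbT_mem [B, A])
    (hS.transfer [a, B] hS.twist_neg_two_TbtAbbT_mem [B])
    (hS.transfer [A, A, B, A] hS.twist_neg_one_TBTabbTaBT_mem [A, B])

theorem twist_neg_three_tbABaabt_mem : twist (-3) [t, b, A, B, a, a, b, t] ∈ S :=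
  hS.line_b _ [t, b, A] [a, a, b, t] 0 (-1) (hS.transfer [B] (hS.mem_one (-2) (-1)) [A, B])
    (hS.transfer [a, B] hS.twist_neg_two_TbtAbbT_mem [B, A, A, A])
    (hS.transfer [a] hS.twist_neg_three_tbaaBaabt_mem [A])

theorem twist_neg_three_bt_mem : twist (-3) [b, t] ∈ S :=
  hS.line_t _ [] [b, t] 1 0 (hS.transfer [A, B] (hS.mem_one (-2) (-1)) [A, B, A])
    (hS.transfer [A] hS.twist_neg_two_tBT_mem [A, B, A])

theorem twist_neg_three_tt_mem : twist (-3) [t, t] ∈ S := by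
  have twist_neg_three_tbbt_mem : twist (-3) [t, b, b, t] ∈ S :=
    hS.line_t _ [t, b] [b, t] 1 0 (hS.transfer [A] hS.twist_neg_two_tBT_mem [B, A])
      (hS.transfer [A, B] (hS.mem_two (-1) (-1) [B, A, A, B] (-1)) [A, A, B, A])
  exact hS.line_b _ [t] [t] 1 0 (hS.transfer [A, B] (hS.mem_one (-2) (-1)) [A, B, A])
    (hS.transfer [] twist_neg_three_tbbt_mem [])
    (hS.transfer [] hS.twist_neg_three_tbABaabt_mem [a])

theorem levelOne_neg_three : LevelOne S (-3) := fun i => by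
  have twist_neg_three_tbBT_mem : twist (-3) [t, b, B, T] ∈ S :=
    hS.line_t _ [t, b] [B, T] 1 0 (hS.transfer [B, B] hS.twist_neg_three_bt_mem [b])
      (hS.transfer [B] hS.twist_neg_three_tt_mem [b])
  simpa [translate_eq, Letter.eval] using hS.line_t (zeta ^ (-3 : ℤ)) [] [] 0 i
    (hS.transfer [] twist_neg_three_tbBT_mem []) (hS.transfer [B] hS.twist_neg_three_bt_mem []) rfl

end HasWindow

namespace IsSaturated

variable {S : Set Braid} (hS : IsSaturated S)
include hS

theorem levelOne_of_succ {k : ℤ} (h : ∀ m < 6, LevelOne S (k + 1 + (m : ℕ))) : LevelOne S k := by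
  have hwindow : HasWindow ((zeta ^ (k + 3) * ·) ⁻¹' S) := by
    refine ⟨hS.preimage_mul_zeta_zpow _, fun l h₁ h₂ => ?_⟩
    rw [levelOne_preimage_mul_zeta_zpow]
    convert h (l + 2).toNat (by lia) using 1
    lia
  simpa using (levelOne_preimage_mul_zeta_zpow ..).mp hwindow.levelOne_neg_three

theorem levelOne_add_six {k : ℤ} (h : ∀ m < 6, LevelOne S (k + (m : ℕ))) :
    LevelOne S (k + (6 : ℕ)) := by
  have := (hS.preimage_invert.levelOne_of_succ (k := -(k + (6 : ℕ))) fun m hm => by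
    convert (h (5 - m) (by lia)).preimage_invert using 1
    lia).preimage_invert
  rwa [preimage_invert_preimage_invert, neg_neg] at this

end IsSaturated

namespace HasWindow

variable {S : Set Braid} (hS : HasWindow S)
include hS

theorem levelOne_all (k : ℤ) : LevelOne S k :=
  forall_of_window (fun _ => hS.levelOne_add_six) (fun _ => hS.levelOne_of_succ) (i := -2)
    (fun m hm => hS.levelOne _ (by lia) (by lia)) k

theorem levelTwo_all (k : ℤ) : LevelTwo S k :=
  hS.levelTwo_of_le fun l _ _ => hS.levelOne_all l

end HasWindow

namespace IsLeftSaturated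

variable {S : Set Braid} (hS : IsLeftSaturated S)
include hS

theorem preimage_mul_right (x : Braid) : IsLeftSaturated ((· * x) ⁻¹' S) where
  toIsLineClosed := hS.toIsLineClosed.preimage_mul_right x
  mul_mem_left hh hx := by
    rw [Set.mem_preimage, mul_assoc]
    exact hS.mul_mem_left hh hx

theorem hasWindow_rightCore_preimage_mul_gen (hcore : HasWindow (rightCore S)) (g : Gen) :
    HasWindow (rightCore ((· * gen g) ⁻¹' S)) := by
  refine ⟨(hS.preimage_mul_right _).isSaturated_rightCore, fun k _ _ i h hh => ?_⟩
  have of_mem (hg : gen g ∈ parabolic) :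
      zeta ^ k * gen Gen.t ^ i * h ∈ (· * gen g) ⁻¹' S := by
    rw [Set.mem_preimage, mul_assoc _ h]
    exact hcore.levelOne_all k i _ (mul_mem hh hg)
  cases g with
  | s1 => exact of_mem gen_s1_mem_parabolic
  | s2 => exact of_mem gen_s2_mem_parabolic
  | t => simpa [mul_assoc] using rightCore_subset S (hcore.levelTwo_all k i 1 h hh)

theorem mem_of_hasWindow_rightCore (hcore : HasWindow (rightCore S)) (x : Braid) : x ∈ S := by
  have hsub := closure_subset_of_isLineClosed
    (𝒞 := {S | IsLeftSaturated S ∧ HasWindow (rightCore S)}) subset_rfl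
    (fun S hS => by simpa using rightCore_subset S (hS.2.levelOne_all 0 0))
    (fun S hS => hS.1.toIsLineClosed) ?_ ⟨hS, hcore⟩
  · rw [closure_range_gen] at hsub
    exact hsub (Subgroup.mem_top x)
  · rintro S hS _ ⟨g, rfl⟩
    exact ⟨hS.1.preimage_mul_right _, hS.1.hasWindow_rightCore_preimage_mul_gen hS.2 g⟩

end IsLeftSaturated

/-- The exponents of `ζ` that occur in the 54 words `cosetWord`, starting with `0` so that the first
of these words is empty. -/
def exponent : Fin 6 → ℤ := ![0, 1, 2, 3, -1, -2]

/-- The 54 words `ζ ^ k` and `ζ ^ k t r`, with `r` a representative, whose images generate the Hecke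
algebra as a left `A₃`-module. -/
def cosetWord (p : Fin 6 × Fin 9) : Word :=
  .zpow Word.center (exponent p.1) ++
    (Fin.cases [] (fun j => t :: representative j) p.2 : Word)

theorem exists_exponent_eq {k : ℤ} (h₁ : -2 ≤ k) (h₂ : k ≤ 3) : ∃ i, exponent i = k := by
  interval_cases k
  exacts [⟨5, rfl⟩, ⟨4, rfl⟩, ⟨0, rfl⟩, ⟨1, rfl⟩, ⟨2, rfl⟩, ⟨3, rfl⟩]

namespace IsLeftSaturated

variable {S : Set Braid} (hS : IsLeftSaturated S)
include hS

theorem zeta_zpow_mul_t_mul_mem {k : ℤ}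
    (hmem : ∀ j, zeta ^ k * gen Gen.t * (representative j).eval ∈ S) {h : Braid}
    (hh : h ∈ parabolic) : zeta ^ k * gen Gen.t * h ∈ S := by
  refine (hS.toIsLineClosed.preimage_mul_left _).parabolic_subset ?_ hh
  rintro ⟨m, r⟩
  have hcomm : Commute (zeta ^ k * gen Gen.t) (gen Gen.s1 ^ (m : ℕ)) :=
    (((commute_zeta _).zpow_left k).mul_left gen_t_mul_gen_s1).pow_right m
  simpa [parabolicWord, Letter.eval, hcomm.left_comm] using
    hS.mul_mem_left (pow_mem gen_s1_mem_parabolic m) (hmem r)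

theorem levelOne_rightCore {k : ℤ} (hk : zeta ^ k ∈ S)
    (hmem : ∀ j, zeta ^ k * gen Gen.t * (representative j).eval ∈ S) :
    LevelOne (rightCore S) k := fun i h hh =>
  hS.line_mem Gen.t _ h 0 (fun
    | 0, _ => by
      simpa [((commute_zeta h).zpow_left k).eq] using hS.mul_mem_left hh hk
    | 1, _ => by simpa using hS.zeta_zpow_mul_t_mul_mem hmem hh) i

theorem mem_of_cosetWord (h : ∀ p, (cosetWord p).eval ∈ S) (x : Braid) : x ∈ S := by
  refine hS.mem_of_hasWindow_rightCore ⟨hS.isSaturated_rightCore, fun k h₁ h₂ => ?_⟩ x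
  obtain ⟨i, rfl⟩ := exists_exponent_eq h₁ h₂
  refine hS.levelOne_rightCore ?_ fun j => ?_
  · simpa [cosetWord, zeta] using h (i, 0)
  · simpa [cosetWord, zeta, Letter.eval, mul_assoc] using h (i, j.succ)

end IsLeftSaturated

/-! ### The Hecke algebra -/

theorem mem_of_recurrence {k M : Type*} [CommRing k] [AddCommGroup M] [Module k M]
    (N : Submodule k M) {n : ℕ} {coeff : ℕ → k} (hcoeff : IsUnit (coeff 0)) {f : ℤ → M}
    (hf : ∀ i, f (i + n) = ∑ m ∈ Finset.range n, coeff m • f (i + m)) {i : ℤ}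
    (h : ∀ m < n, f (i + m) ∈ N) (j : ℤ) : f j ∈ N := by
  refine forall_of_window (Q := (f · ∈ N)) (fun i hi => ?_) (fun i hi => ?_) h j
  · rw [hf]
    exact sum_mem fun m hm => N.smul_mem _ (hi m (Finset.mem_range.mp hm))
  · obtain _ | n := n
    · simpa using congrArg (· ∈ N) (hf i)
    have hsucc (m : ℕ) : i + ((m + 1 : ℕ) : ℤ) = i + 1 + m := by lia
    have hi₀ := hf i
    simp only [Finset.sum_range_succ', hsucc, Nat.cast_zero, add_zero] at hi₀
    rw [← N.smul_mem_iff_of_isUnit hcoeff, ← sub_eq_of_eq_add' hi₀]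
    exact sub_mem (hi n n.lt_succ_self)
      (sum_mem fun m hm => N.smul_mem _ (hi m (by have := Finset.mem_range.mp hm; lia)))

theorem span_range_mul_eq_top {k A ι κ : Type*} [CommSemiring k] [Semiring A] [Algebra k A]
    {S : Subalgebra k A} {u : ι → A} {v : κ → A}
    (hu : Submodule.span k (Set.range u) = Subalgebra.toSubmodule S)
    (hv : Submodule.span S (Set.range v) = ⊤) :
    Submodule.span k (Set.range fun p : ι × κ => u p.1 * v p.2) = ⊤ := by
  rw [← Set.image2_range, Set.image2_mul, ← Submodule.span_mul_span, hu, eq_top_iff]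
  rintro x -
  obtain ⟨c, rfl⟩ := Finsupp.mem_span_range_iff_exists_finsupp.mp (hv ▸ Submodule.mem_top (x := x))
  exact sum_mem fun j _ => Submodule.mul_mem_mul (c j).2 (Submodule.subset_span ⟨j, rfl⟩)

section Hecke

variable {k : Type} [CommRing k]

/-- The coefficient of `g ^ m` in the Hecke relation that expresses `g ^ order g` through lower
powers of the generator `g`; meaningful for `m < order g` only. -/
def heckeCoeff (a b c d e : k) : Gen → ℕ → k
  | .t, 0 => e
  | .t, _ => d
  | _, 0 => c
  | _, 1 => b
  | _, _ => a

/-- The subalgebra `⟨s₁, s₂⟩` of the Hecke algebra over any base ring; it is `A3` over `R`. -/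
noncomputable def parabolicSubalgebra (k : Type) [CommRing k] (a b c d e : k) :
    Subalgebra k (Hecke k a b c d e) :=
  Algebra.adjoin k {ofBraid k a b c d e (gen Gen.s1), ofBraid k a b c d e (gen Gen.s2)}

variable {a b c d e : k}

theorem ofBraid_gen_pow_order (g : Gen) :
    ofBraid k a b c d e (gen g) ^ order g =
      ∑ m ∈ Finset.range (order g),
        heckeCoeff a b c d e g m • ofBraid k a b c d e (gen g) ^ m := by
  have hrel : HeckeRel k a b c d e (MonoidAlgebra.of k Braid (gen g) ^ order g)
      (∑ m ∈ Finset.range (order g),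
        heckeCoeff a b c d e g m • MonoidAlgebra.of k Braid (gen g) ^ m) := by
    cases g <;> simp only [order, heckeCoeff, Finset.sum_range_succ', Finset.sum_range_zero,
      pow_zero, pow_one, zero_add]
    exacts [.s1, .s2, .t]
  have hquot := RingQuot.mkAlgHom_rel k hrel
  simp only [map_pow, map_sum, map_smul] at hquot
  exact hquot

theorem isLineClosed_preimage_ofBraid (hc : IsUnit c) (he : IsUnit e)
    (M : Submodule k (Hecke k a b c d e)) : IsLineClosed (ofBraid k a b c d e ⁻¹' M) where
  line_mem g p q i h j := by
    refine mem_of_recurrence M (n := order g) (coeff := heckeCoeff a b c d e g)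
      (f := fun j => ofBraid k a b c d e (p * gen g ^ j * q)) ?_ (fun i => ?_) h j
    · cases g <;> assumption
    · simp only [zpow_add, zpow_natCast, map_mul, map_pow, ofBraid_gen_pow_order, Finset.mul_sum,
        Finset.sum_mul, mul_smul_comm, smul_mul_assoc]

theorem span_range_ofBraid : Submodule.span k (Set.range (ofBraid k a b c d e)) = ⊤ := by
  rw [eq_top_iff]
  rintro x -
  obtain ⟨y, rfl⟩ := RingQuot.mkAlgHom_surjective k (HeckeRel k a b c d e) x
  induction y using MonoidAlgebra.induction_on with
  | of g => exact Submodule.subset_span ⟨g, rfl⟩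
  | add f g hf hg => rw [map_add]; exact add_mem hf hg
  | smul r f hf => rw [map_smul]; exact Submodule.smul_mem _ r hf

theorem ofBraid_mem_parabolicSubalgebra (hc : IsUnit c) (he : IsUnit e) {h : Braid}
    (hh : h ∈ parabolic) : ofBraid k a b c d e h ∈ parabolicSubalgebra k a b c d e := by
  refine closure_subset_of_isLineClosed
    (𝒞 := {S | IsLineClosed S ∧ ofBraid k a b c d e ⁻¹' parabolicSubalgebra k a b c d e ⊆ S})
    ?_ (fun S hS => hS.2 (by simp)) (fun S hS => hS.1) ?_
    ⟨isLineClosed_preimage_ofBraid hc he (parabolicSubalgebra k a b c d e).toSubmodule, subset_rfl⟩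
    hh
  · rintro _ (rfl | rfl) <;> exact Set.mem_range_self _
  · refine fun S hS g hg => ⟨hS.1.preimage_mul_right g, fun x hx => hS.2 ?_⟩
    rw [Set.mem_preimage, map_mul]
    refine mul_mem hx (Algebra.subset_adjoin ?_)
    obtain rfl | rfl := hg
    exacts [Or.inl rfl, Or.inr rfl]

theorem span_parabolicWord (hc : IsUnit c) (he : IsUnit e) :
    Submodule.span k (Set.range fun p => ofBraid k a b c d e (parabolicWord p).eval) =
      Subalgebra.toSubmodule (parabolicSubalgebra k a b c d e) := by
  apply le_antisymm
  · rw [Submodule.span_le]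
    rintro _ ⟨p, rfl⟩
    exact ofBraid_mem_parabolicSubalgebra hc he (eval_parabolicWord_mem p)
  · rw [parabolicSubalgebra, Algebra.adjoin_eq_span, Submodule.span_le]
    have hle : Submonoid.closure
        {ofBraid k a b c d e (gen Gen.s1), ofBraid k a b c d e (gen Gen.s2)} ≤
          parabolic.toSubmonoid.map (ofBraid k a b c d e) := by
      rw [Submonoid.closure_le]
      rintro _ (rfl | rfl)
      exacts [⟨_, gen_s1_mem_parabolic, rfl⟩, ⟨_, gen_s2_mem_parabolic, rfl⟩]
    intro x hx
    obtain ⟨h, hh, rfl⟩ := hle hx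
    exact (isLineClosed_preimage_ofBraid hc he _).parabolic_subset
      (fun p => Submodule.subset_span (Set.mem_range_self p)) hh

theorem span_cosetWord (hc : IsUnit c) (he : IsUnit e) :
    Submodule.span (parabolicSubalgebra k a b c d e)
      (Set.range fun p => ofBraid k a b c d e (cosetWord p).eval) = ⊤ := by
  set M := Submodule.span (parabolicSubalgebra k a b c d e)
    (Set.range fun p => ofBraid k a b c d e (cosetWord p).eval)
  have hM : IsLeftSaturated (ofBraid k a b c d e ⁻¹' (M.restrictScalars k)) := by
    refine ⟨isLineClosed_preimage_ofBraid hc he _, fun {h x} hh hx => ?_⟩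
    rw [Set.mem_preimage, map_mul]
    exact M.smul_mem ⟨_, ofBraid_mem_parabolicSubalgebra hc he hh⟩ hx
  rw [← Submodule.restrictScalars_eq_top_iff k, eq_top_iff, ← span_range_ofBraid, Submodule.span_le]
  rintro _ ⟨x, rfl⟩
  exact hM.mem_of_cosetWord (fun p => Submodule.subset_span (Set.mem_range_self p)) x

end Hecke

theorem isUnit_param_c : IsUnit (param Param.c) :=
  isUnit_of_mul_isUnit_left (y := param Param.e) <| by
    rw [param, param, ← map_mul]
    exact IsLocalization.Away.algebraMap_isUnit _

theorem isUnit_param_e : IsUnit (param Param.e) :=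
  isUnit_of_mul_isUnit_right (x := param Param.c) <| by
    rw [param, param, ← map_mul]
    exact IsLocalization.Away.algebraMap_isUnit _

end G26

theorem mainTheorem2_general {k : Type} [CommRing k] {a b c d e : k} (hc : IsUnit c)
    (he : IsUnit e) :
    ∃ (x : Fin 24 → G26.Braid) (y : Fin 54 → G26.Braid) (z : Fin 1296 → G26.Braid),
      x 0 = 1 ∧ y 0 = 1 ∧ z 0 = 1 ∧
      (∀ i, x i ∈ Subgroup.closure {G26.gen G26.Gen.s1, G26.gen G26.Gen.s2}) ∧
      Set.range z = Set.range (fun p : Fin 24 × Fin 54 => x p.1 * y p.2) ∧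
      Submodule.span (G26.parabolicSubalgebra k a b c d e)
        (Set.range fun j => G26.ofBraid k a b c d e (y j)) = ⊤ ∧
      Submodule.span k (Set.range fun i => G26.ofBraid k a b c d e (x i)) =
        Subalgebra.toSubmodule (G26.parabolicSubalgebra k a b c d e) ∧
      Submodule.span k (Set.range fun l => G26.ofBraid k a b c d e (z l)) = ⊤ := by
  let ex : Fin 24 ≃ Fin 3 × Fin 8 := (finProdFinEquiv (m := 3) (n := 8)).symm
  let ey : Fin 54 ≃ Fin 6 × Fin 9 := (finProdFinEquiv (m := 6) (n := 9)).symm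
  let ez : Fin 1296 ≃ Fin 24 × Fin 54 := (finProdFinEquiv (m := 24) (n := 54)).symm
  let x (i : Fin 24) : G26.Braid := (G26.parabolicWord (ex i)).eval
  let y (j : Fin 54) : G26.Braid := (G26.cosetWord (ey j)).eval
  have hx : Submodule.span k (Set.range fun i => G26.ofBraid k a b c d e (x i)) =
      Subalgebra.toSubmodule (G26.parabolicSubalgebra k a b c d e) := by
    rw [← G26.span_parabolicWord hc he]
    exact congrArg _ (ex.surjective.range_comp fun p =>
      G26.ofBraid k a b c d e (G26.parabolicWord p).eval)
  have hy : Submodule.span (G26.parabolicSubalgebra k a b c d e)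
      (Set.range fun j => G26.ofBraid k a b c d e (y j)) = ⊤ := by
    rw [← G26.span_cosetWord hc he]
    exact congrArg _ (ey.surjective.range_comp fun p =>
      G26.ofBraid k a b c d e (G26.cosetWord p).eval)
  have hx0 : x 0 = 1 := rfl
  have hy0 : y 0 = 1 := rfl
  refine ⟨x, y, fun l => x (ez l).1 * y (ez l).2, hx0, hy0, ?_,
    fun i => G26.eval_parabolicWord_mem _, ?_, hy, hx, ?_⟩
  · have hz0 : ez 0 = (0, 0) := rfl
    simp only [hz0, hx0, hy0, mul_one]
  · exact ez.surjective.range_comp fun p => x p.1 * y p.2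
  · rw [← G26.span_range_mul_eq_top hx hy]
    simp only [map_mul]
    exact congrArg _ (ez.surjective.range_comp fun p =>
      G26.ofBraid k a b c d e (x p.1) * G26.ofBraid k a b c d e (y p.2))

/-- `Â` is generated by 54 elements as a left `A₃`-module, `A₃` is spanned by 24 elements over `R`,
and the products form a family of 1296 elements spanning `Â` over `R`; all these elements are
images of braid group elements, and `1` is among them. -/
theorem mainTheorem2 :
    ∃ (x : Fin 24 → G26.Braid) (y : Fin 54 → G26.Braid) (z : Fin 1296 → G26.Braid),
      x 0 = 1 ∧ y 0 = 1 ∧ z 0 = 1 ∧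
      (∀ i, x i ∈ Subgroup.closure {G26.gen G26.Gen.s1, G26.gen G26.Gen.s2}) ∧
      Set.range z = Set.range (fun p : Fin 24 × Fin 54 => x p.1 * y p.2) ∧
      Submodule.span G26.A3 (Set.range fun j => G26.toHecke (y j)) = ⊤ ∧
      Submodule.span G26.R (Set.range fun i => G26.toHecke (x i)) =
        Subalgebra.toSubmodule G26.A3 ∧
      Submodule.span G26.R (Set.range fun k => G26.toHecke (z k)) = ⊤ :=
  mainTheorem2_general G26.isUnit_param_c G26.isUnit_param_e
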